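/- **Setting.** Let $K$ be a non-empty finite index set, let $A_k$ ($k\in K$) and $Z$ be $\{0,1\}$-valued random variables on one probability space, and let $(((A_k)_i)_{k\in K},Z_i)$, $i=1,2,\dots$, be independent copies of $((A_k)_{k\in K},Z)$. Write $E_nY=n^{-1}\sum_{i=1}^nY_i$ for the sample average of the first $n$ observations. For each $k\in K$ let $g_k:\mathbb R^3\to\mathbb R$ be differentiable at the point $x^{(k)}=(E[ZA_k],E[A_k],E[Z])$, put $$M_k=g_k(E[ZA_k],E[A_k],E[Z]),\qquad \hat M_k=g_k(E_nZA_k,E_nA_k,E_nZ),$$ $$H_k=d_1g_k\,ZA_k+d_2g_k\,A_k+d_3g_k\,Z,\qquad V_{jk}=\operatorname{cov}(H_j,H_k),$$ where $d_rg_k=\partial g_k/\partial x_r$ is evaluated at $x^{(k)}$, and assume that the matrix $V=(V_{jk})_{j,k\in K}$ is positive definite. Let $R_{jk}=V_{jk}/\sqrt{V_{jj}V_{kk}}$ be its correlation matrix and $\Phi$ the standard normal cumulative distribution function. A sequence $\tilde V=\tilde V^{(n)}$ of random matrices is called a consistent estimator of $V$ if $\tilde V_{jk}/V_{jk}\to1$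 in probability as $n\to\infty$ for all $j,k\in K$ with $V_{jk}\neq0$ (this holds in particular if $\tilde V_{jk}\to V_{jk}$ in probability for all $j,k$); square roots of negative numbers are read as $0$. **Proposition 1.** As $n\to\infty$: (i) $\sqrt n(\hat M_k-M_k)_{k\in K}=\sqrt n\,\bigl(E_n(H_k-E[H_k])\bigr)_{k\in K}+o_p(1)$, where $E_n(H_k-E[H_k])$ is the average of $d_1g_k\,Z_i(A_k)_i+d_2g_k\,(A_k)_i+d_3g_k\,Z_i-E[H_k]$ over $i\le n$, and $\sqrt n(\hat M_k-M_k)_{k\in K}$ converges in distribution to $N(0,V)$. (ii) For every consistent estimator $\tilde V$ of $V$, every $\alpha\in(0,1)$ and every $k\in K$, $$\lim_{n\to\infty}P\Bigl[\,|M_k-\hat M_k|\le\Phi^{-1}(1-\alpha/2)\,n^{-1/2}\sqrt{\tilde V_{kk}}\,\Bigr]=1-\alpha.$$ (iii) For every $\alpha\in(0,1)$ there is a number $q$ with $P[\max_{j\in K}|z_j|<q]=1-\alpha$ for $(z_j)_{j\in K}\sim N(0,R)$; and for every such $q$, every consistent estimator $\tilde V$ of $V$, and every sequence of random variables $\tilde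 q=\tilde q^{(n)}$ that converges to $q$ in probability, $$\lim_{n\to\infty}P\Bigl[\,|M_k-\hat M_k|\le\tilde q\,n^{-1/2}\sqrt{\tilde V_{kk}}\ \text{ for all }k\in K\Bigr]=1-\alpha.$$ -/

import Mathlib

open MeasureTheory ProbabilityTheory Filter Topology

noncomputable section

namespace PerfMeasure

/-- The sample average `E_n Y = n⁻¹ ∑ Y_i` of the first `n` members of a sequence of random
variables (indexed from `0`). -/
def sampleMean {Ω : Type*} (Y : ℕ → Ω → ℝ) (n : ℕ) (ω : Ω) : ℝ :=
  (n : ℝ)⁻¹ * ∑ i ∈ Finset.range n, Y i ω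

/-- The true parameter point `(E ZA, E A, E Z)` of a rule `A` and a response `Z`. -/
def trueParam {Ω : Type*} [MeasurableSpace Ω] (P : Measure Ω) (A Z : Ω → ℝ) : Fin 3 → ℝ :=
  ![∫ ω, Z ω * A ω ∂P, ∫ ω, A ω ∂P, ∫ ω, Z ω ∂P]

/-- The empirical point `(E_n ZA, E_n A, E_n Z)` computed from the first `n` observations
`(A_i, Z_i)`. -/
def empParam {Ω : Type*} (A Z : ℕ → Ω → ℝ) (n : ℕ) (ω : Ω) : Fin 3 → ℝ :=
  ![sampleMean (fun i ω => Z i ω * A i ω) n ω, sampleMean A n ω, sampleMean Z n ω]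

/-- The partial derivative `∂g/∂x_r` of a function of three real variables at the point `x`. -/
def partialDeriv (r : Fin 3) (g : (Fin 3 → ℝ) → ℝ) (x : Fin 3 → ℝ) : ℝ :=
  deriv (fun t => g (Function.update x r t)) (x r)

/-- The linear combination `d₁g · za + d₂g · a + d₃g · z`, the partial derivatives of `g` being
taken at the point `x`. -/
def linComb (g : (Fin 3 → ℝ) → ℝ) (x : Fin 3 → ℝ) (a z : ℝ) : ℝ :=
  partialDeriv 0 g x * (z * a) + partialDeriv 1 g x * a + partialDeriv 2 g x * z

/-- The random variable `H = d₁g · ZA + d₂g · A + d₃g · Z`, the partial derivatives of `g` being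
taken at the true point `(E ZA, E A, E Z)`. -/
def H {Ω : Type*} [MeasurableSpace Ω] (P : Measure Ω) (g : (Fin 3 → ℝ) → ℝ) (A Z : Ω → ℝ) :
    Ω → ℝ :=
  fun ω => linComb g (trueParam P A Z) (A ω) (Z ω)

/-- The matrix `V`, `V_{jk} = cov (H_j, H_k)`. -/
def V {K Ω : Type*} [MeasurableSpace Ω] (P : Measure Ω) (g : K → (Fin 3 → ℝ) → ℝ)
    (A : K → Ω → ℝ) (Z : Ω → ℝ) : Matrix K K ℝ :=
  Matrix.of fun j k => covariance (H P (g j) (A j) Z) (H P (g k) (A k) Z) P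

/-- The correlation matrix of a covariance matrix: `R_{jk} = V_{jk} / √(V_{jj} V_{kk})`. -/
def corrMatrix {K : Type*} (V : Matrix K K ℝ) : Matrix K K ℝ :=
  Matrix.of fun j k => V j k / √(V j j * V k k)

/-- The inverse `Φ⁻¹` of the standard normal cumulative distribution function `Φ`, as a quantile
function. -/
def stdNormalQuantile (p : ℝ) : ℝ := sInf {x : ℝ | p ≤ cdf (gaussianReal 0 1) x}

/-- `q` is a value of `q(α, R)`: it satisfies `P[max_j |z_j| < q] = 1 - α` for `z ∼ N(0, R)`. -/
def IsMaxAbsQuantile {K : Type*} [Fintype K] [DecidableEq K] [Nonempty K]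
    (R : Matrix K K ℝ) (α q : ℝ) : Prop :=
  (multivariateGaussian (0 : EuclideanSpace ℝ K) R).real
    {z | Finset.univ.sup' Finset.univ_nonempty (fun j => |z j|) < q} = 1 - α

/-- Consistency of the estimators `Vt n` (one random matrix for each sample size `n`): each ratio
`Ṽ_{jk} / V_{jk}` with `V_{jk} ≠ 0` tends to `1` in probability. This holds in particular if
`Ṽ_{jk} → V_{jk}` in probability for all `j, k`; the diagonal entries are always among the ratios
when `V` is positive definite. -/
def IsConsistent {K Ω : Type*} [MeasurableSpace Ω] (P : Measure Ω)
    (Vt : ℕ → K → K → Ω → ℝ) (V : Matrix K K ℝ) : Prop :=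
  (∀ n j k, AEMeasurable (Vt n j k) P) ∧
    ∀ j k, V j k ≠ 0 →
      TendstoInMeasure P (fun n ω => Vt n j k ω / V j k) atTop (fun _ => (1 : ℝ))

/-- The random interval `center ± c · n^{-1/2} · √v`. -/
def waldInterval (center c v : ℝ) (n : ℕ) : Set ℝ :=
  Set.Icc (center - c * (√(n : ℝ))⁻¹ * √v) (center + c * (√(n : ℝ))⁻¹ * √v)

end PerfMeasure

end

open PerfMeasure

/-!
The result is the delta method, followed by Slutsky's theorem.

The empirical point `(E_n ZA, E_n A, E_n Z)` is within `O_p(n^{-1/2})` of the true one, by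
Chebyshev's inequality. Differentiability of `g` at the true point alone therefore makes the
remainder of its first order expansion, multiplied by `√n`, tend to `0` in probability
(`tendstoInMeasure_deltaMethod`, `tendstoInMeasure_plugIn_sub_sampleMean`). The linear part is a
normalized sum of independent copies of the vector `(H_k)`, whose covariance matrix is `V`, and
the multivariate central limit theorem `tendstoInDistribution_multivariateGaussian` applies; it
follows from the one-dimensional theorem and Lévy's continuity theorem, by evaluating
characteristic functions along each direction. As `g` may be irregular away from the true point,
the measurability of `g(E_n ZA, E_n A, E_n Z)` rests on the empirical point having only countably
many values (`measurable_comp_empParam`).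

For the intervals, coverage for all `k` in a set `s` of indices says that
`max_{k ∈ s} (|√n (M̂_k - M_k)| / √V_kk - q̃ √(Ṽ_kk / V_kk))` is at most `0`. By Slutsky's theorem
this maximum converges in distribution to `max_{k ∈ s} |z_k| - q` with `z ∼ N(0, R)`, whose law
has no atom at `0`, so the coverage probabilities converge
(`tendsto_measureReal_forall_abs_le`). The individual intervals are the case of a singleton `s`,
where the limit is computed from the symmetry of the standard normal law, and the joint ones the
case of all indices. The absence of atoms also provides the quantile `q`
(`exists_isMaxAbsQuantile`) and makes `Φ (Φ⁻¹ p) = p`.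
-/

open PerfMeasure
open scoped Matrix

/-! ### Quantiles of atomless laws on the line -/

lemma continuous_cdf_of_nullSingletonClass (μ : Measure ℝ) [IsProbabilityMeasure μ]
    [NullSingletonClass μ] : Continuous (cdf μ) := by
  refine continuous_iff_continuousAt.2 fun x => ?_
  refine (cdf μ).mono.continuousAt_iff_leftLim_eq_rightLim.2 ?_
  have h : (cdf μ).measure {x} = 0 := by rw [measure_cdf]; simp
  rw [StieltjesFunction.measure_singleton, ENNReal.ofReal_eq_zero] at h
  rw [(cdf μ).rightLim_eq]
  exact le_antisymm ((cdf μ).mono.leftLim_le le_rfl) (by linarith)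

/-- The quantile function of an atomless law is a right inverse of its distribution function. -/
lemma cdf_sInf_of_nullSingletonClass (μ : Measure ℝ) [IsProbabilityMeasure μ]
    [NullSingletonClass μ] {p : ℝ} (hp : p ∈ Set.Ioo (0 : ℝ) 1) :
    cdf μ (sInf {x | p ≤ cdf μ x}) = p := by
  have hc := continuous_cdf_of_nullSingletonClass μ
  have hne : {x | p ≤ cdf μ x}.Nonempty :=
    (((tendsto_cdf_atTop μ).eventually_const_lt hp.2).exists).imp fun _ h => h.le
  obtain ⟨b, hb⟩ := ((tendsto_cdf_atBot μ).eventually_lt_const hp.1).exists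
  have hbdd : BddBelow {x | p ≤ cdf μ x} :=
    ⟨b, fun x hx => le_of_not_gt fun hxb => (hx.trans (monotone_cdf μ hxb.le)).not_gt hb⟩
  refine le_antisymm ?_ ((isClosed_le continuous_const hc).csInf_mem hne hbdd)
  -- below the infimum `cdf μ < p`, so that `cdf μ ≤ p` at the infimum by continuity
  refine le_of_tendsto (x := 𝓝[<] sInf {x | p ≤ cdf μ x}) hc.continuousWithinAt ?_
  filter_upwards [self_mem_nhdsWithin] with x hx
  exact le_of_not_ge fun h => notMem_of_lt_csInf hx hbdd h

lemma gaussianReal_real_abs_le_stdNormalQuantile {α : ℝ} (hα : α ∈ Set.Ioo (0 : ℝ) 1) :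
    (gaussianReal 0 1).real {x | |x| ≤ stdNormalQuantile (1 - α / 2)} = 1 - α := by
  have : NullSingletonClass (gaussianReal 0 1) := nullSingletonClass_gaussianReal one_ne_zero
  set μ := gaussianReal 0 1 with hμ
  set q := stdNormalQuantile (1 - α / 2)
  have hF : cdf μ q = 1 - α / 2 :=
    cdf_sInf_of_nullSingletonClass μ ⟨by linarith [hα.2], by linarith [hα.1]⟩
  -- the symmetry of the normal law
  have hneg : cdf μ (-q) = α / 2 := by
    have hsymm : μ.map (fun x => -x) = μ := by simp [hμ, gaussianReal_map_neg]
    have h1 : μ.real (Set.Iic (-q)) = μ.real (Set.Ici q) := by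
      conv_lhs => rw [← hsymm]
      rw [map_measureReal_apply (by fun_prop) measurableSet_Iic]
      congr 1
      ext x
      simp
    have h2 : μ.real (Set.Ici q) = 1 - μ.real (Set.Iic q) := by
      rw [← measureReal_congr Ioi_ae_eq_Ici, ← Set.compl_Iic,
        probReal_compl_eq_one_sub measurableSet_Iic]
    rw [cdf_eq_real, h1, h2, ← cdf_eq_real, hF]
    ring
  -- needed for `Iic (-q) ⊆ Iic q`; it holds because `α / 2 < 1 - α / 2`
  have hq0 : -q ≤ q := by
    by_contra! h
    have := monotone_cdf μ h.le
    rw [hF, hneg] at this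
    linarith [hα.2]
  have hset : {x : ℝ | |x| ≤ q} = Set.Icc (-q) q := by
    ext x
    simp [abs_le]
  rw [hset, ← measureReal_congr Ioc_ae_eq_Icc, ← Set.Iic_sdiff_Iic,
    measureReal_sdiff (Set.Iic_subset_Iic.2 hq0) measurableSet_Iic, ← cdf_eq_real,
    ← cdf_eq_real, hF, hneg]
  ring

/-! ### Normal vectors and the multivariate central limit theorem -/

lemma corrMatrix_eq {K : Type*} [Fintype K] [DecidableEq K] {S : Matrix K K ℝ} (hS : S.PosDef) :
    corrMatrix S = Matrix.diagonal (fun k => (√(S k k))⁻¹) * S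
      * Matrix.diagonal (fun k => (√(S k k))⁻¹) := by
  ext j k
  rw [Matrix.mul_diagonal, Matrix.diagonal_mul, corrMatrix, Matrix.of_apply,
    Real.sqrt_mul hS.diag_pos.le, div_eq_mul_inv, mul_inv]
  ring

lemma corrMatrix_posSemidef {K : Type*} [Fintype K] [DecidableEq K] {S : Matrix K K ℝ}
    (hS : S.PosDef) : (corrMatrix S).PosSemidef := by
  rw [corrMatrix_eq hS]
  simpa using hS.posSemidef.mul_mul_conjTranspose_same (Matrix.diagonal (fun k => (√(S k k))⁻¹))

lemma corrMatrix_diag {K : Type*} [Fintype K] [DecidableEq K] {S : Matrix K K ℝ}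
    (hS : S.PosDef) (k : K) : corrMatrix S k k = 1 := by
  rw [corrMatrix, Matrix.of_apply, Real.sqrt_mul_self hS.diag_pos.le, div_self hS.diag_pos.ne']

/-- Dividing the coordinates of an `N(0, S)` vector by their standard deviations gives an
`N(0, R)` vector, `R` the correlation matrix of `S`. -/
lemma map_standardize_multivariateGaussian {K : Type*} [Fintype K] [DecidableEq K]
    {S : Matrix K K ℝ} (hS : S.PosDef) :
    (multivariateGaussian (0 : EuclideanSpace ℝ K) S).map
        (fun x => WithLp.toLp 2 (fun k => (√(S k k))⁻¹ * x k)) =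
      multivariateGaussian 0 (corrMatrix S) := by
  have hm : Measurable (fun x : EuclideanSpace ℝ K =>
      (WithLp.toLp 2 (fun k => (√(S k k))⁻¹ * x k) : EuclideanSpace ℝ K)) := by fun_prop
  have : IsProbabilityMeasure ((multivariateGaussian (0 : EuclideanSpace ℝ K) S).map
        (fun x => (WithLp.toLp 2 (fun k => (√(S k k))⁻¹ * x k) : EuclideanSpace ℝ K))) :=
    Measure.isProbabilityMeasure_map hm.aemeasurable
  refine Measure.ext_of_charFun (funext fun t => ?_)
  have h : charFun ((multivariateGaussian (0 : EuclideanSpace ℝ K) S).map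
        (fun x => (WithLp.toLp 2 (fun k => (√(S k k))⁻¹ * x k) : EuclideanSpace ℝ K))) t =
      charFun (multivariateGaussian (0 : EuclideanSpace ℝ K) S)
        (WithLp.toLp 2 (fun k => (√(S k k))⁻¹ * t k)) := by
    rw [charFun_apply, charFun_apply, integral_map hm.aemeasurable (by fun_prop)]
    congr with x
    congr 3
    simp only [PiLp.inner_apply, RCLike.inner_apply, conj_trivial]
    exact Finset.sum_congr rfl fun k _ => by ring
  rw [h, charFun_multivariateGaussian hS.posSemidef,
    charFun_multivariateGaussian (corrMatrix_posSemidef hS), corrMatrix_eq hS]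
  have hD : (fun k => (√(S k k))⁻¹ * t k) = Matrix.diagonal (fun k => (√(S k k))⁻¹) *ᵥ t := by
    ext k
    simp [Matrix.mulVec_diagonal]
  simp only [inner_zero_right, hD]
  congr 4
  simp [← Matrix.mulVec_mulVec, Matrix.dotProduct_mulVec, Matrix.vecMul_mulVec]

/-- The **multivariate central limit theorem** for independent identically distributed
square-integrable random vectors. -/
theorem tendstoInDistribution_multivariateGaussian {K : Type*} [Fintype K] [DecidableEq K]
    {Ω : Type*} [MeasurableSpace Ω] {P : Measure Ω} [IsProbabilityMeasure P]
    {X : ℕ → Ω → EuclideanSpace ℝ K} {S : Matrix K K ℝ} (hS : S.PosSemidef)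
    (hcov : ∀ j k, S j k = covariance (fun ω => X 0 ω j) (fun ω => X 0 ω k) P)
    (hX : MemLp (X 0) 2 P) (hindep : iIndepFun X P)
    (hident : ∀ i, IdentDistrib (X i) (X 0) P P) :
    TendstoInDistribution
      (fun (n : ℕ) ω => (√(n : ℝ))⁻¹ • (∑ i ∈ Finset.range n, X i ω - (n : ℝ) • P[X 0]))
      atTop (id : EuclideanSpace ℝ K → EuclideanSpace ℝ K) (fun _ => P)
      (multivariateGaussian 0 S) where
  forall_aemeasurable n := by
    have := fun i => (hident i).aemeasurable_fst
    fun_prop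
  tendsto := by
    refine ProbabilityMeasure.tendsto_iff_tendsto_charFun.2 fun t => ?_
    have hm := fun i => (hident i).aemeasurable_fst
    -- the one-dimensional theorem for `⟪X i, t⟫`, whose characteristic functions at `1` are those
    -- of the vectors at `t`
    have hXt : MemLp (fun ω => inner ℝ (X 0 ω) t) 2 P := hX.inner_const t
    have hvar : Var[fun ω => inner ℝ (X 0 ω) t; P] = t ⬝ᵥ S *ᵥ t := by
      have hc : ∀ k, MemLp (fun ω => X 0 ω k) 2 P := fun k =>
        (EuclideanSpace.proj (𝕜 := ℝ) k).comp_memLp' hX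
      simp only [PiLp.inner_apply, RCLike.inner_apply, conj_trivial]
      rw [variance_fun_sum (fun k => (hc k).const_mul (t k))]
      simp_rw [covariance_const_mul_left, covariance_const_mul_right, ← hcov,
        dotProduct, Matrix.mulVec, dotProduct, Finset.mul_sum]
      exact Finset.sum_congr rfl fun j _ => Finset.sum_congr rfl fun k _ => by ring
    have h1 := (tendstoInDistribution_inv_sqrt_mul_sum_sub (P := P)
      (P' := gaussianReal 0 Var[fun ω => inner ℝ (X 0 ω) t; P].toNNReal) (Y := id)
      (X := fun i ω => inner ℝ (X i ω) t) HasLaw.id hXt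
      (hindep.comp (fun _ x => inner ℝ x t) (fun _ => by fun_prop))
      (fun i => (hident i).comp (u := fun x => inner ℝ x t) (by fun_prop))).tendsto
    have h2 := ProbabilityMeasure.tendsto_iff_tendsto_charFun.1 h1 1
    simp only [ProbabilityMeasure.coe_mk, Measure.map_id] at h2 ⊢
    rw [charFun_multivariateGaussian hS]
    rw [charFun_gaussianReal, hvar] at h2
    have h0 : 0 ≤ t ⬝ᵥ S *ᵥ t := hvar ▸ variance_nonneg _ _
    convert! h2 using 2 with n
    · have hm1 : AEMeasurable (fun ω => (√(n : ℝ))⁻¹ •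
          (∑ i ∈ Finset.range n, X i ω - (n : ℝ) • P[X 0])) P := by fun_prop
      have hm2 : AEMeasurable (fun ω => (√(n : ℝ))⁻¹ *
          (∑ i ∈ Finset.range n, inner ℝ (X i ω) t
            - (n : ℝ) * ∫ ω, inner ℝ (X 0 ω) t ∂P)) P := by fun_prop
      have hint : ∫ ω, inner ℝ (X 0 ω) t ∂P = inner ℝ (P[X 0]) t := by
        simp_rw [real_inner_comm t]
        exact integral_inner (hX.integrable (by norm_num)) t
      rw [charFun_apply, charFun_apply, integral_map hm1 (by fun_prop),
        integral_map hm2 (by fun_prop)]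
      congr with ω
      simp [hint, inner_smul_left, inner_sub_left, sum_inner]
    · simp [Real.coe_toNNReal _ h0]

/-! ### Convergence in probability -/

lemma MeasureTheory.TendstoInMeasure.pi {K ι Ω : Type*} [Fintype K] [MeasurableSpace Ω]
    {P : Measure Ω}
    {E : K → Type*} [∀ k, PseudoMetricSpace (E k)]
    {l : Filter ι} {X : ι → Ω → (∀ k, E k)} {Y : Ω → ∀ k, E k}
    (h : ∀ k, TendstoInMeasure P (fun n ω => X n ω k) l (fun ω => Y ω k)) :
    TendstoInMeasure P X l Y := by
  rw [tendstoInMeasure_iff_dist]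
  intro ε hε
  have hsum : Tendsto (fun n => ∑ k, P {ω | ε ≤ dist (X n ω k) (Y ω k)}) l (𝓝 0) := by
    simpa using tendsto_finsetSum Finset.univ
      fun k _ => (tendstoInMeasure_iff_dist.1 (h k)) ε hε
  refine tendsto_of_tendsto_of_tendsto_of_le_of_le tendsto_const_nhds hsum
    (fun _ => zero_le) fun n => ?_
  refine (measure_mono fun ω hω => ?_).trans (measure_iUnion_fintype_le P _)
  by_contra hc
  simp only [Set.mem_iUnion, Set.mem_ofPred_eq, not_exists, not_le] at hc
  exact hω.not_gt ((dist_pi_lt_iff hε).2 hc)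

lemma MeasureTheory.TendstoInMeasure.prodMk {ι Ω E F : Type*} [MeasurableSpace Ω] {P : Measure Ω}
    [PseudoMetricSpace E] [PseudoMetricSpace F]
    {l : Filter ι} {X : ι → Ω → E} {X' : Ω → E} {Y : ι → Ω → F} {Y' : Ω → F}
    (hX : TendstoInMeasure P X l X') (hY : TendstoInMeasure P Y l Y') :
    TendstoInMeasure P (fun n ω => (X n ω, Y n ω)) l (fun ω => (X' ω, Y' ω)) := by
  rw [tendstoInMeasure_iff_dist] at *
  intro ε hε
  have hsum := (hX ε hε).add (hY ε hε)
  rw [add_zero] at hsum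
  refine tendsto_of_tendsto_of_tendsto_of_le_of_le tendsto_const_nhds hsum
    (fun _ => zero_le) fun n => (measure_mono fun ω hω => ?_).trans (measure_union_le _ _)
  simpa [Prod.dist_eq] using hω

lemma MeasureTheory.TendstoInMeasure.lipschitz_comp {ι Ω E F : Type*} [MeasurableSpace Ω]
    {P : Measure Ω}
    [PseudoMetricSpace E] [PseudoMetricSpace F] {l : Filter ι} {X : ι → Ω → E} {Y : Ω → E}
    {f : E → F} {C : NNReal} (hf : LipschitzWith C f) (h : TendstoInMeasure P X l Y) :
    TendstoInMeasure P (fun n ω => f (X n ω)) l (fun ω => f (Y ω)) := by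
  rw [tendstoInMeasure_iff_dist] at *
  intro ε hε
  refine tendsto_of_tendsto_of_tendsto_of_le_of_le tendsto_const_nhds
    (h (ε / (C + 1)) (by positivity)) (fun _ => zero_le) fun n => measure_mono fun ω hω => ?_
  simp only [Set.mem_ofPred_eq] at hω ⊢
  rw [div_le_iff₀ (by positivity)]
  nlinarith [hf.dist_le_mul (X n ω) (Y ω), dist_nonneg (x := X n ω) (y := Y ω)]

/-- The remainder in the **delta method**: if `√n (Y_n - x)` is bounded in probability and `g` is
differentiable at `x`, then `√n (g (Y_n) - g x) - √n g'(x) (Y_n - x)` tends to `0` in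
probability. No regularity of `g` away from `x` is needed. -/
theorem tendstoInMeasure_deltaMethod {Ω E F : Type*} [MeasurableSpace Ω] {P : Measure Ω}
    [NormedAddCommGroup E] [NormedSpace ℝ E] [NormedAddCommGroup F] [NormedSpace ℝ F]
    {Y : ℕ → Ω → E} {x : E} {g : E → F} {g' : E →L[ℝ] F} (hg : HasFDerivAt g g' x)
    (hY : ∀ δ > 0, ∃ C > 0, ∀ n : ℕ, P {ω | C ≤ √(n : ℝ) * ‖Y n ω - x‖} ≤ δ) :
    TendstoInMeasure P
      (fun (n : ℕ) ω => √(n : ℝ) • (g (Y n ω) - g x) - √(n : ℝ) • g' (Y n ω - x))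
      atTop (fun _ => 0) := by
  rw [tendstoInMeasure_iff_norm]
  intro η hη
  rw [ENNReal.tendsto_nhds_zero]
  intro δ hδ
  obtain ⟨C, hC, hbound⟩ := hY δ hδ
  -- with slope `η / (2 C)`, the remainder times `√n` is at most `η / 2` where `√n ‖Y - x‖ < C`
  obtain ⟨r, hr, hrem⟩ := Metric.eventually_nhds_iff.1
    ((hasFDerivAt_iff_isLittleO.1 hg).def (c := η / (2 * C)) (by positivity))
  have hlarge : ∀ᶠ n : ℕ in atTop, C / r < √(n : ℝ) :=
    (Real.tendsto_sqrt_atTop.comp tendsto_natCast_atTop_atTop).eventually_gt_atTop _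
  filter_upwards [hlarge] with n hn
  refine (measure_mono fun ω hω => ?_).trans (hbound n)
  by_contra hc
  simp only [Set.mem_ofPred_eq, not_le, sub_zero, ← smul_sub, norm_smul, Real.norm_eq_abs,
    abs_of_nonneg (Real.sqrt_nonneg _)] at hω hc
  have hn0 : 0 < √(n : ℝ) := (by positivity : 0 < C / r).trans hn
  have hnear : dist (Y n ω) x < r := by
    rw [dist_eq_norm]
    rw [div_lt_iff₀ hr] at hn
    nlinarith
  have h1 := mul_le_mul_of_nonneg_left (hrem hnear) hn0.le
  have h2 : η / (2 * C) * (√(n : ℝ) * ‖Y n ω - x‖) ≤ η / (2 * C) * C := by gcongr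
  have h3 : η / (2 * C) * C = η / 2 := by field_simp
  linarith [h1, (by ring : √(n : ℝ) * (η / (2 * C) * ‖Y n ω - x‖)
    = η / (2 * C) * (√(n : ℝ) * ‖Y n ω - x‖))]

/-! ### Sample averages -/

/-- **Chebyshev's inequality** for the average of independent variables with values in `[0, 1]`
and a common mean. -/
lemma measure_le_sqrt_mul_abs_sampleMean_sub_le {Ω : Type*} [MeasurableSpace Ω] {P : Measure Ω}
    [IsProbabilityMeasure P] {U : ℕ → Ω → ℝ} {m : ℝ} (hU : ∀ i, Measurable (U i))
    (h01 : ∀ i ω, U i ω ∈ Set.Icc (0 : ℝ) 1) (hindep : iIndepFun U P) (hm : ∀ i, P[U i] = m)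
    {C : ℝ} (hC : 0 < C) (n : ℕ) :
    P {ω | C ≤ √(n : ℝ) * |sampleMean U n ω - m|} ≤ ENNReal.ofReal (1 / C ^ 2) := by
  have hL : ∀ i, MemLp (U i) 2 P := fun i =>
    MemLp.of_bound (hU i).aestronglyMeasurable 1 (ae_of_all _ fun ω => by
      rw [Real.norm_eq_abs, abs_of_nonneg (h01 i ω).1]; exact (h01 i ω).2)
  have hsumL : MemLp (fun ω => ∑ i ∈ Finset.range n, U i ω) 2 P :=
    memLp_finsetSum _ fun i _ => hL i
  have hvar : Var[fun ω => ∑ i ∈ Finset.range n, U i ω; P] ≤ n := by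
    have h := IndepFun.variance_sum (s := Finset.range n) (fun i _ => hL i)
      (fun i _ j _ hij => hindep.indepFun hij)
    have heq : (∑ i ∈ Finset.range n, U i) = fun ω => ∑ i ∈ Finset.range n, U i ω := by
      ext ω; simp
    rw [heq] at h
    rw [h]
    calc ∑ i ∈ Finset.range n, Var[U i; P] ≤ ∑ i ∈ Finset.range n, (1 : ℝ) := by
          refine Finset.sum_le_sum fun i _ => ?_
          have := variance_le_sq_of_bounded (μ := P) (X := U i) (a := 0) (b := 1)
            (ae_of_all _ (h01 i)) (hU i).aemeasurable
          linarith
      _ = n := by simp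
  have hmean : ∫ ω, ∑ i ∈ Finset.range n, U i ω ∂P = n * m := by
    rw [integral_finsetSum _ fun i _ => (hL i).integrable (by norm_num)]
    simp [hm]
  rcases Nat.eq_zero_or_pos n with rfl | hn
  · have : {ω | C ≤ √((0 : ℕ) : ℝ) * |sampleMean U 0 ω - m|} = ∅ := by
      ext ω; simpa using hC
    rw [this]; simp
  have hn' : (0 : ℝ) < n := by exact_mod_cast hn
  have hs : 0 < √(n : ℝ) := Real.sqrt_pos.2 hn'
  have hss : √(n : ℝ) * √(n : ℝ) = n := Real.mul_self_sqrt hn'.le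
  have h := meas_ge_le_variance_div_sq hsumL (c := C * √(n : ℝ)) (by positivity)
  rw [hmean] at h
  refine (measure_mono fun ω hω => ?_).trans (h.trans (ENNReal.ofReal_le_ofReal ?_))
  · simp only [Set.mem_ofPred_eq] at hω ⊢
    have : ∑ i ∈ Finset.range n, U i ω - n * m = n * (sampleMean U n ω - m) := by
      rw [sampleMean]; field_simp
    rw [this, abs_mul, abs_of_pos hn']
    calc C * √(n : ℝ) ≤ √(n : ℝ) * |sampleMean U n ω - m| * √(n : ℝ) := by gcongr
      _ = √(n : ℝ) * √(n : ℝ) * |sampleMean U n ω - m| := by ring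
      _ = n * |sampleMean U n ω - m| := by rw [hss]
  · rw [mul_pow, Real.sq_sqrt hn'.le, div_le_div_iff₀ (by positivity) (by positivity)]
    nlinarith [sq_nonneg C]

/-! ### Coverage of studentized statistics -/

lemma ae_abs_ne_multivariateGaussian {K : Type*} [Fintype K] [DecidableEq K]
    {R : Matrix K K ℝ} (hR : R.PosSemidef) {k : K} (hk : R k k ≠ 0) (q : ℝ) :
    ∀ᵐ z ∂(multivariateGaussian (0 : EuclideanSpace ℝ K) R), |z k| ≠ q := by
  have hmp := measurePreserving_eval_multivariateGaussian (μ := (0 : EuclideanSpace ℝ K)) hR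
    (i := k)
  have hpos : 0 < R k k := lt_of_le_of_ne hR.diag_nonneg hk.symm
  have : NullSingletonClass (gaussianReal ((0 : EuclideanSpace ℝ K) k) (R k k).toNNReal) :=
    nullSingletonClass_gaussianReal (by simpa using hpos)
  refine hmp.quasiMeasurePreserving.ae (p := fun x : ℝ => |x| ≠ q) ?_
  have hfin : ({q, -q} : Set ℝ).Finite := Set.toFinite _
  filter_upwards [compl_mem_ae_iff.2 (hfin.measure_zero _)] with x hx hxq
  refine hx ?_
  rcases abs_choice x with h | h <;> rw [h] at hxq <;> simp [← hxq]

/-- The law of the largest absolute value of some coordinates of a normal vector has no atoms. -/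
lemma ae_sup_abs_ne_multivariateGaussian {K : Type*} [Fintype K] [DecidableEq K]
    {R : Matrix K K ℝ} (hR : R.PosSemidef) (hdiag : ∀ k, R k k ≠ 0) {s : Finset K}
    (hs : s.Nonempty) (q : ℝ) :
    ∀ᵐ z ∂(multivariateGaussian (0 : EuclideanSpace ℝ K) R), s.sup' hs (fun k => |z k|) ≠ q := by
  filter_upwards [ae_all_iff.2 fun k => ae_abs_ne_multivariateGaussian hR (hdiag k) q] with z hz h
  obtain ⟨k, -, hk⟩ := s.exists_mem_eq_sup' hs (fun k => |z k|)
  exact hz k (hk.symm.trans h)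

/-- Values of `q(α, R)` exist, because the law of `max_j |z_j|` has no atoms. -/
lemma exists_isMaxAbsQuantile {K : Type*} [Fintype K] [DecidableEq K] [Nonempty K]
    {R : Matrix K K ℝ} (hR : R.PosSemidef) (hdiag : ∀ k, R k k ≠ 0) {α : ℝ}
    (hα : α ∈ Set.Ioo (0 : ℝ) 1) : ∃ q, IsMaxAbsQuantile R α q := by
  have hm : Measurable fun z : EuclideanSpace ℝ K =>
      Finset.univ.sup' Finset.univ_nonempty (fun j => |z j|) :=
    (Continuous.finset_sup'_apply _ fun k _ => by fun_prop).measurable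
  set ν := (multivariateGaussian (0 : EuclideanSpace ℝ K) R).map fun z =>
      Finset.univ.sup' Finset.univ_nonempty (fun j => |z j|) with hν
  have : IsProbabilityMeasure ν := Measure.isProbabilityMeasure_map hm.aemeasurable
  have hnull : NullSingletonClass ν := ⟨fun q => by
    rw [hν, Measure.map_apply hm (measurableSet_singleton q)]
    have h := ae_sup_abs_ne_multivariateGaussian hR hdiag Finset.univ_nonempty q
    rw [ae_iff] at h
    exact measure_mono_null (fun z hz => not_not.2 hz) h⟩
  refine ⟨sInf {x | 1 - α ≤ cdf ν x}, ?_⟩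
  have h := cdf_sInf_of_nullSingletonClass ν (p := 1 - α) ⟨by linarith [hα.2], by linarith [hα.1]⟩
  rw [cdf_eq_real, ← measureReal_congr Iio_ae_eq_Iic, hν,
    map_measureReal_apply hm measurableSet_Iio] at h
  exact h

/-- Joint coverage of studentized statistics: if `T_n` converges in distribution to `N(0, S)`,
if the relative errors `W_n k` of the variance estimators tend to `1` and the critical values to
`q` in probability, then the probability that `|T_n k| ≤ q_n √(S_kk W_n k)` for all `k ∈ s` tends
to the probability that `|z k| ≤ q` for all `k ∈ s`, for `z` normal with the correlation matrix
of `S` as covariance matrix. -/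
theorem tendsto_measureReal_forall_abs_le {K : Type*} [Fintype K] [DecidableEq K]
    {Ω : Type*} [MeasurableSpace Ω] {P : Measure Ω} [IsProbabilityMeasure P]
    {S : Matrix K K ℝ} (hS : S.PosDef) {T : ℕ → Ω → EuclideanSpace ℝ K}
    (hT : TendstoInDistribution T atTop (id : EuclideanSpace ℝ K → EuclideanSpace ℝ K)
      (fun _ => P) (multivariateGaussian 0 S))
    {W : ℕ → K → Ω → ℝ} (hWm : ∀ n k, AEMeasurable (W n k) P)
    (hW : ∀ k, TendstoInMeasure P (fun n => W n k) atTop (fun _ => (1 : ℝ)))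
    {qt : ℕ → Ω → ℝ} {q : ℝ} (hqm : ∀ n, AEMeasurable (qt n) P)
    (hq : TendstoInMeasure P qt atTop (fun _ => q)) {s : Finset K} (hs : s.Nonempty) :
    Tendsto (fun n => P.real {ω | ∀ k ∈ s, |T n ω k| ≤ qt n ω * √(S k k * W n k ω)}) atTop
      (𝓝 ((multivariateGaussian (0 : EuclideanSpace ℝ K) (corrMatrix S)).real
        {z | ∀ k ∈ s, |z k| ≤ q})) := by
  have hsd : ∀ k, 0 < √(S k k) := fun k => Real.sqrt_pos.2 hS.diag_pos
  -- the largest excess over the critical value is a continuous function of all the ingredients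
  let G : EuclideanSpace ℝ K × (ℝ × (K → ℝ)) → ℝ := fun p =>
    s.sup' hs fun k => |(√(S k k))⁻¹ * p.1 k| - p.2.1 * √(p.2.2 k)
  have hG : Continuous G := Continuous.finset_sup'_apply _ fun k _ => by fun_prop
  have hconv := hT.continuous_comp_prodMk_of_tendstoInMeasure_const hG
    (Y := fun n ω => (qt n ω, fun k => W n k ω)) (c := (q, fun _ => 1))
    (hq.prodMk (TendstoInMeasure.pi hW))
    (fun n => (hqm n).prodMk (aemeasurable_pi_lambda _ (hWm n)))
  -- the law of the limit, in terms of the correlation matrix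
  let F : EuclideanSpace ℝ K → ℝ := fun z => s.sup' hs fun k => |z k| - q
  have hF : Measurable F :=
    (Continuous.finset_sup'_apply _ fun k _ => by fun_prop).measurable
  have hlaw : (multivariateGaussian (0 : EuclideanSpace ℝ K) S).map
        (fun x => G (x, (q, fun _ => 1))) =
      (multivariateGaussian (0 : EuclideanSpace ℝ K) (corrMatrix S)).map F := by
    rw [← map_standardize_multivariateGaussian hS, Measure.map_map hF (by fun_prop)]
    congr with x
    simp [G, F]
  have hnull : (multivariateGaussian (0 : EuclideanSpace ℝ K) (corrMatrix S)).map F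
      (frontier (Set.Iic 0)) = 0 := by
    rw [frontier_Iic, Measure.map_apply hF (measurableSet_singleton 0)]
    have h := ae_sup_abs_ne_multivariateGaussian (corrMatrix_posSemidef hS)
      (fun k => by simp [corrMatrix_diag hS]) hs q
    rw [ae_iff] at h
    refine measure_mono_null (fun z hz => ?_) h
    simp only [ne_eq, not_not, Set.mem_ofPred_eq]
    have hz' : F z = 0 := hz
    have hcomp := Finset.apply_sup'_eq_sup'_comp (s := s) hs (f := fun k => |z k|)
      (fun x : ℝ => x - q) (fun x y => (max_sub_sub_right x y q).symm)
    have : s.sup' hs (fun k => |z k|) - q = F z := hcomp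
    linarith
  have hport := ProbabilityMeasure.tendsto_measure_of_null_frontier_of_tendsto' hconv.tendsto
    (E := Set.Iic 0) (by
      simp only [ProbabilityMeasure.coe_mk, id]
      rw [hlaw, hnull])
  simp only [ProbabilityMeasure.coe_mk] at hport
  have := Measure.isProbabilityMeasure_map hconv.aemeasurable_limit
  have hport' := (ENNReal.tendsto_toReal (measure_ne_top _ _)).comp hport
  convert! hport' using 2 with n
  · simp only [Function.comp]
    rw [Measure.map_apply_of_aemeasurable (hconv.forall_aemeasurable n) measurableSet_Iic,
      Measure.real]
    congr 2
    ext ω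
    simp only [G, Set.mem_ofPred_eq, Set.mem_preimage, Set.mem_Iic, Finset.sup'_le_iff, sub_nonpos]
    refine forall₂_congr fun k _ => ?_
    rw [abs_mul, abs_of_pos (inv_pos.2 (hsd k)), inv_mul_le_iff₀ (hsd k),
      Real.sqrt_mul hS.diag_pos.le, mul_left_comm]
  · simp only [id]
    rw [hlaw, Measure.map_apply hF measurableSet_Iic, Measure.real]
    congr 2
    ext z
    simp [F]

lemma mem_waldInterval_iff {m c z v : ℝ} {n : ℕ} (hn : 0 < n) :
    m ∈ waldInterval z c v n ↔ |√(n : ℝ) * (z - m)| ≤ c * √v := by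
  have hs : 0 < √(n : ℝ) := Real.sqrt_pos.2 (by exact_mod_cast hn)
  have h : c * (√(n : ℝ))⁻¹ * √v = (c * √v) / √(n : ℝ) := by field_simp
  rw [waldInterval, Set.mem_Icc, h, abs_mul, abs_of_pos hs, ← le_div_iff₀' hs, abs_le]
  constructor <;> rintro ⟨h1, h2⟩ <;> constructor <;> linarith

/-! ### Linearization of plug-in estimators -/

/-- The average of `n` variables with values in `{0, 1}` is `n⁻¹` times a natural number. Its values
thus lie in a countable set, so that any function of it, however irregular, is measurable. -/
lemma exists_measurable_nat_sampleMean_eq {Ω : Type*} [MeasurableSpace Ω] {U : ℕ → Ω → ℝ}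
    (hU : ∀ i, Measurable (U i)) (h01 : ∀ i ω, U i ω = 0 ∨ U i ω = 1) (n : ℕ) :
    ∃ N : Ω → ℕ, Measurable N ∧ ∀ ω, sampleMean U n ω = (n : ℝ)⁻¹ * N ω := by
  refine ⟨fun ω => ∑ i ∈ Finset.range n, ⌊U i ω⌋₊, ?_, fun ω => ?_⟩
  · exact Finset.measurable_fun_sum _ fun i _ => Nat.measurable_floor.comp (hU i)
  · rw [sampleMean]
    push_cast
    congr 1
    refine Finset.sum_congr rfl fun i _ => ?_
    rcases h01 i ω with h | h <;> simp [h]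

lemma measurable_comp_empParam {Ω : Type*} [MeasurableSpace Ω] {A Z : ℕ → Ω → ℝ}
    (hA : ∀ i, Measurable (A i)) (hZ : ∀ i, Measurable (Z i))
    (hA01 : ∀ i ω, A i ω = 0 ∨ A i ω = 1) (hZ01 : ∀ i ω, Z i ω = 0 ∨ Z i ω = 1)
    (g : (Fin 3 → ℝ) → ℝ) (n : ℕ) : Measurable fun ω => g (empParam A Z n ω) := by
  obtain ⟨N₀, hN₀, h₀⟩ := exists_measurable_nat_sampleMean_eq (U := fun i ω => Z i ω * A i ω)
    (fun i => (hZ i).mul (hA i))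
    (fun i ω => by rcases hA01 i ω with h | h <;> rcases hZ01 i ω with h' | h' <;> simp [h, h']) n
  obtain ⟨N₁, hN₁, h₁⟩ := exists_measurable_nat_sampleMean_eq hA hA01 n
  obtain ⟨N₂, hN₂, h₂⟩ := exists_measurable_nat_sampleMean_eq hZ hZ01 n
  have : (fun ω => g (empParam A Z n ω)) = (fun m : ℕ × ℕ × ℕ =>
      g ![(n : ℝ)⁻¹ * m.1, (n : ℝ)⁻¹ * m.2.1, (n : ℝ)⁻¹ * m.2.2]) ∘
        fun ω => (N₀ ω, N₁ ω, N₂ ω) := by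
    ext ω
    simp [empParam, h₀, h₁, h₂]
  rw [this]
  exact (measurable_of_countable _).comp (hN₀.prodMk (hN₁.prodMk hN₂))

lemma fderiv_apply_eq_sum_partialDeriv {g : (Fin 3 → ℝ) → ℝ} {x : Fin 3 → ℝ}
    (hg : DifferentiableAt ℝ g x) (v : Fin 3 → ℝ) :
    fderiv ℝ g x v = partialDeriv 0 g x * v 0 + partialDeriv 1 g x * v 1
      + partialDeriv 2 g x * v 2 := by
  have hp : ∀ r, partialDeriv r g x = fderiv ℝ g x (Pi.single r 1) := fun r => by
    have h : HasFDerivAt g (fderiv ℝ g x) (Function.update x r (x r)) := by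
      simpa using hg.hasFDerivAt
    exact (h.comp_hasDerivAt (x r) (hasDerivAt_update x r (x r))).deriv
  rw [hp, hp, hp]
  conv_lhs => rw [pi_eq_sum_univ' v]
  simp only [Fin.sum_univ_three, map_add, map_smul, smul_eq_mul]
  ring

/-- `√n (E_n - x)` is bounded in probability, where `E_n` is the empirical point and `x` the true
one: Chebyshev's inequality in each of the three coordinates. -/
lemma exists_measure_le_sqrt_mul_norm_empParam_sub_le {Ω : Type*} [MeasurableSpace Ω]
    {P : Measure Ω} [IsProbabilityMeasure P] {A Z : ℕ → Ω → ℝ} {x : Fin 3 → ℝ}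
    (hAm : ∀ i, Measurable (A i)) (hZm : ∀ i, Measurable (Z i))
    (hA : ∀ i ω, A i ω = 0 ∨ A i ω = 1) (hZ : ∀ i ω, Z i ω = 0 ∨ Z i ω = 1)
    (hindep : iIndepFun (fun i ω => (A i ω, Z i ω)) P)
    (hx : ∀ i, trueParam P (A i) (Z i) = x) {δ : ENNReal} (hδ : 0 < δ) :
    ∃ C > 0, ∀ n : ℕ, P {ω | C ≤ √(n : ℝ) * ‖empParam A Z n ω - x‖} ≤ δ := by
  have hlim : Tendsto (fun C : ℝ => (3 : ENNReal) * ENNReal.ofReal (1 / C ^ 2)) atTop (𝓝 0) := by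
    have h1 : Tendsto (fun C : ℝ => 1 / C ^ 2) atTop (𝓝 0) := by
      simpa [Function.comp_def] using
        tendsto_inv_atTop_zero.comp (tendsto_pow_atTop (α := ℝ) two_ne_zero)
    have h2 := ENNReal.Tendsto.const_mul (a := 3) (ENNReal.tendsto_ofReal h1)
      (Or.inr (by norm_num))
    simpa using h2
  obtain ⟨C, hCδ, hC⟩ :=
    ((ENNReal.tendsto_nhds_zero.1 hlim δ hδ).and (eventually_gt_atTop 0)).exists
  refine ⟨C, hC, fun n => ?_⟩
  have hcheb : ∀ (φ : ℝ × ℝ → ℝ) (m : ℝ), Measurable φ →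
      (∀ i ω, φ (A i ω, Z i ω) ∈ Set.Icc (0 : ℝ) 1) → (∀ i, ∫ ω, φ (A i ω, Z i ω) ∂P = m) →
      P {ω | C ≤ √(n : ℝ) * |sampleMean (fun i ω => φ (A i ω, Z i ω)) n ω - m|}
        ≤ ENNReal.ofReal (1 / C ^ 2) := fun φ m hφ h01 hm =>
    measure_le_sqrt_mul_abs_sampleMean_sub_le (fun i => hφ.comp ((hAm i).prodMk (hZm i))) h01
      (hindep.comp (fun _ => φ) fun _ => hφ) hm hC n
  have h0 := hcheb (fun p => p.2 * p.1) (x 0) (by fun_prop)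
    (fun i ω => by rcases hA i ω with h | h <;> rcases hZ i ω with h' | h' <;> simp [h, h'])
    (fun i => by rw [← hx i]; rfl)
  have h1 := hcheb (fun p => p.1) (x 1) (by fun_prop)
    (fun i ω => by rcases hA i ω with h | h <;> simp [h]) (fun i => by rw [← hx i]; rfl)
  have h2 := hcheb (fun p => p.2) (x 2) (by fun_prop)
    (fun i ω => by rcases hZ i ω with h | h <;> simp [h]) (fun i => by rw [← hx i]; rfl)
  -- the norm on `Fin 3 → ℝ` is the maximum norm
  have hcover : {ω | C ≤ √(n : ℝ) * ‖empParam A Z n ω - x‖} ⊆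
      {ω | C ≤ √(n : ℝ) * |sampleMean (fun i ω => Z i ω * A i ω) n ω - x 0|} ∪
      ({ω | C ≤ √(n : ℝ) * |sampleMean A n ω - x 1|} ∪
        {ω | C ≤ √(n : ℝ) * |sampleMean Z n ω - x 2|}) := by
    intro ω hω
    obtain ⟨r, hr⟩ : ∃ r, ‖empParam A Z n ω - x‖ = |empParam A Z n ω r - x r| := by
      obtain ⟨r, -, hr⟩ := Finset.univ.exists_mem_eq_sup' Finset.univ_nonempty
        (fun r => ‖(empParam A Z n ω - x) r‖₊)
      refine ⟨r, ?_⟩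
      rw [← Real.norm_eq_abs, ← Pi.sub_apply, ← coe_nnnorm, ← coe_nnnorm, Pi.nnnorm_def,
        ← Finset.sup'_eq_sup Finset.univ_nonempty, hr]
    simp only [Set.mem_ofPred_eq, hr] at hω
    fin_cases r
    · exact Or.inl hω
    · exact Or.inr (Or.inl hω)
    · exact Or.inr (Or.inr hω)
  calc P {ω | C ≤ √(n : ℝ) * ‖empParam A Z n ω - x‖}
      ≤ _ := (measure_mono hcover).trans
        ((measure_union_le _ _).trans (add_le_add_right (measure_union_le _ _) _))
    _ ≤ ENNReal.ofReal (1 / C ^ 2) +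
        (ENNReal.ofReal (1 / C ^ 2) + ENNReal.ofReal (1 / C ^ 2)) :=
        add_le_add h0 (add_le_add h1 h2)
    _ = 3 * ENNReal.ofReal (1 / C ^ 2) := by ring
    _ ≤ δ := hCδ

lemma integral_linComb {Ω : Type*} [MeasurableSpace Ω] {P : Measure Ω} [IsProbabilityMeasure P]
    {A Z : Ω → ℝ} (hAm : Measurable A) (hZm : Measurable Z) (hA : ∀ ω, A ω = 0 ∨ A ω = 1)
    (hZ : ∀ ω, Z ω = 0 ∨ Z ω = 1) (g : (Fin 3 → ℝ) → ℝ) (x : Fin 3 → ℝ) :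
    ∫ ω, linComb g x (A ω) (Z ω) ∂P = partialDeriv 0 g x * trueParam P A Z 0
      + partialDeriv 1 g x * trueParam P A Z 1 + partialDeriv 2 g x * trueParam P A Z 2 := by
  have hAi : Integrable A P := Integrable.of_bound hAm.aestronglyMeasurable 1
    (ae_of_all _ fun ω => by rcases hA ω with h | h <;> simp [h])
  have hZi : Integrable Z P := Integrable.of_bound hZm.aestronglyMeasurable 1
    (ae_of_all _ fun ω => by rcases hZ ω with h | h <;> simp [h])
  have hZAi : Integrable (fun ω => Z ω * A ω) P :=
    Integrable.of_bound (hZm.mul hAm).aestronglyMeasurable 1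
      (ae_of_all _ fun ω => by
        rcases hA ω with h | h <;> rcases hZ ω with h' | h' <;> simp [h, h'])
  simp only [linComb]
  rw [integral_add (by fun_prop) (hZi.const_mul _),
    integral_add (hZAi.const_mul _) (hAi.const_mul _), integral_const_mul, integral_const_mul,
    integral_const_mul]
  rfl

/-- Without the factor `√n` this would fail for `n = 0`, where `sampleMean` is `0`. -/
lemma sqrt_mul_sampleMean_sub_const {Ω : Type*} (Y : ℕ → Ω → ℝ) (m : ℝ) (n : ℕ) (ω : Ω) :
    √(n : ℝ) * sampleMean (fun i ω => Y i ω - m) n ω = √(n : ℝ) * (sampleMean Y n ω - m) := by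
  rcases Nat.eq_zero_or_pos n with rfl | hn
  · simp
  · have hn' : (n : ℝ) ≠ 0 := by exact_mod_cast hn.ne'
    congr 1
    simp only [sampleMean, Finset.sum_sub_distrib, Finset.sum_const, Finset.card_range,
      nsmul_eq_mul]
    field_simp

lemma sampleMean_linComb {Ω : Type*} (A Z : ℕ → Ω → ℝ) (g : (Fin 3 → ℝ) → ℝ) (x : Fin 3 → ℝ)
    (n : ℕ) (ω : Ω) :
    sampleMean (fun i ω => linComb g x (A i ω) (Z i ω)) n ω =
      partialDeriv 0 g x * empParam A Z n ω 0 + partialDeriv 1 g x * empParam A Z n ω 1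
        + partialDeriv 2 g x * empParam A Z n ω 2 := by
  simp only [sampleMean, linComb, empParam, Finset.sum_add_distrib, ← Finset.mul_sum,
    Matrix.cons_val]
  ring

/-- The linear representation of a plug-in estimator: up to an error that tends to `0` in
probability, `√n (g(E_n ZA, E_n A, E_n Z) - g(x))` is `√n` times a centred sample average. -/
theorem tendstoInMeasure_plugIn_sub_sampleMean {Ω : Type*} [MeasurableSpace Ω]
    {P : Measure Ω} [IsProbabilityMeasure P] {A Z : ℕ → Ω → ℝ} {x : Fin 3 → ℝ}
    (hAm : ∀ i, Measurable (A i)) (hZm : ∀ i, Measurable (Z i))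
    (hA : ∀ i ω, A i ω = 0 ∨ A i ω = 1) (hZ : ∀ i ω, Z i ω = 0 ∨ Z i ω = 1)
    (hindep : iIndepFun (fun i ω => (A i ω, Z i ω)) P)
    (hx : ∀ i, trueParam P (A i) (Z i) = x) {g : (Fin 3 → ℝ) → ℝ}
    (hg : DifferentiableAt ℝ g x) :
    TendstoInMeasure P
      (fun (n : ℕ) ω => √(n : ℝ) * (g (empParam A Z n ω) - g x)
        - √(n : ℝ) * sampleMean (fun i ω => linComb g x (A i ω) (Z i ω)
            - ∫ ω', linComb g x (A 0 ω') (Z 0 ω') ∂P) n ω)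
      atTop (fun _ => 0) := by
  have h := tendstoInMeasure_deltaMethod (P := P) (Y := empParam A Z) hg.hasFDerivAt
    fun δ hδ => exists_measure_le_sqrt_mul_norm_empParam_sub_le hAm hZm hA hZ hindep hx hδ
  convert! h using 3 with n ω
  rw [smul_eq_mul, smul_eq_mul, sqrt_mul_sampleMean_sub_const, sampleMean_linComb,
    integral_linComb (hAm 0) (hZm 0) (hA 0) (hZ 0), hx 0, fderiv_apply_eq_sum_partialDeriv hg]
  simp only [Pi.sub_apply]
  ring

/-! ### Asymptotic normality and confidence intervals -/

theorem proposition1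
    {K : Type*} [Fintype K] [DecidableEq K] [Nonempty K]
    -- the population: binary rules `A k` and a binary response `Z`
    {Ω₀ : Type*} [MeasurableSpace Ω₀] (P₀ : Measure Ω₀) [IsProbabilityMeasure P₀]
    (A : K → Ω₀ → ℝ) (Z : Ω₀ → ℝ)
    (hA_meas : ∀ k, Measurable (A k)) (hZ_meas : Measurable Z)
    (hA : ∀ k ω, A k ω = 0 ∨ A k ω = 1) (hZ : ∀ ω, Z ω = 0 ∨ Z ω = 1)
    -- the iid sample `((A_k)_i, Z_i)`, `i = 0, 1, 2, …`
    {Ω : Type*} [MeasurableSpace Ω] (P : Measure Ω) [IsProbabilityMeasure P]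
    (As : ℕ → K → Ω → ℝ) (Zs : ℕ → Ω → ℝ)
    (hAs_meas : ∀ i k, Measurable (As i k)) (hZs_meas : ∀ i, Measurable (Zs i))
    (hAs : ∀ i k ω, As i k ω = 0 ∨ As i k ω = 1) (hZs : ∀ i ω, Zs i ω = 0 ∨ Zs i ω = 1)
    (h_indep : iIndepFun (fun (i : ℕ) (ω : Ω) => ((fun k => As i k ω), Zs i ω)) P)
    (h_ident : ∀ i, IdentDistrib (fun ω : Ω => ((fun k => As i k ω), Zs i ω))
      (fun ω : Ω₀ => ((fun k => A k ω), Z ω)) P P₀)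
    -- the performance measures
    (g : K → (Fin 3 → ℝ) → ℝ)
    (hg : ∀ k, DifferentiableAt ℝ (g k) (trueParam P₀ (A k) Z))
    (hV : (V P₀ g A Z).PosDef)
    -- `M k` is the true value, `Mhat n k` its plug-in estimator
    (M : K → ℝ) (hM : ∀ k, M k = g k (trueParam P₀ (A k) Z))
    (Mhat : ℕ → K → Ω → ℝ)
    (hMhat : ∀ n k ω, Mhat n k ω = g k (empParam (fun i => As i k) Zs n ω)) :
    -- (i) linear representation and asymptotic normality
    (TendstoInMeasure P
        (fun (n : ℕ) ω => WithLp.toLp 2 (fun k =>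
          √(n : ℝ) * (Mhat n k ω - M k)
            - √(n : ℝ) * sampleMean (fun i ω =>
                linComb (g k) (trueParam P₀ (A k) Z) (As i k ω) (Zs i ω)
                  - ∫ ω', H P₀ (g k) (A k) Z ω' ∂P₀) n ω))
        atTop (fun _ => (0 : EuclideanSpace ℝ K)) ∧
      TendstoInDistribution
        (fun (n : ℕ) ω => (WithLp.toLp 2 (fun k => √(n : ℝ) * (Mhat n k ω - M k)) :
          EuclideanSpace ℝ K))
        atTop (id : EuclideanSpace ℝ K → EuclideanSpace ℝ K) (fun _ => P)
        (multivariateGaussian 0 (V P₀ g A Z))) ∧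
    -- (ii) individual confidence intervals
    (∀ Vt : ℕ → K → K → Ω → ℝ, IsConsistent P Vt (V P₀ g A Z) →
      ∀ α ∈ Set.Ioo (0 : ℝ) 1, ∀ k,
        Tendsto (fun n : ℕ => P.real {ω |
            M k ∈ waldInterval (Mhat n k ω) (stdNormalQuantile (1 - α / 2)) (Vt n k k ω) n})
          atTop (𝓝 (1 - α))) ∧
    -- (iii) joint confidence intervals
    (∀ α ∈ Set.Ioo (0 : ℝ) 1,
      (∃ q, IsMaxAbsQuantile (corrMatrix (V P₀ g A Z)) α q) ∧
      ∀ q, IsMaxAbsQuantile (corrMatrix (V P₀ g A Z)) α q →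
      ∀ Vt : ℕ → K → K → Ω → ℝ, IsConsistent P Vt (V P₀ g A Z) →
      ∀ qt : ℕ → Ω → ℝ, (∀ n, AEMeasurable (qt n) P) →
        TendstoInMeasure P qt atTop (fun _ => q) →
        Tendsto (fun n : ℕ => P.real {ω |
            ∀ k, M k ∈ waldInterval (Mhat n k ω) (qt n ω) (Vt n k k ω) n})
          atTop (𝓝 (1 - α))) := by
  -- the summands of the linear representation, as a function of one observation
  let φ : (K → ℝ) × ℝ → EuclideanSpace ℝ K := fun p =>
    WithLp.toLp 2 fun k => linComb (g k) (trueParam P₀ (A k) Z) (p.1 k) p.2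
  have hφ : Measurable φ := by
    have h : ∀ k, Measurable fun p : (K → ℝ) × ℝ =>
        linComb (g k) (trueParam P₀ (A k) Z) (p.1 k) p.2 := fun k => by
      unfold linComb; fun_prop
    fun_prop
  let X : ℕ → Ω → EuclideanSpace ℝ K := fun i ω => φ (fun k => As i k ω, Zs i ω)
  have hXident : ∀ i, IdentDistrib (X i) (fun ω => φ (fun k => A k ω, Z ω)) P P₀ :=
    fun i => (h_ident i).comp hφ
  have hparam : ∀ i k, trueParam P (As i k) (Zs i) = trueParam P₀ (A k) Z := fun i k => by
    have h0 := ((h_ident i).comp (u := fun p => p.2 * p.1 k) (by fun_prop)).integral_eq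
    have h1 := ((h_ident i).comp (u := fun p => p.1 k) (by fun_prop)).integral_eq
    have h2 := ((h_ident i).comp (u := fun p => p.2) (by fun_prop)).integral_eq
    simp only [Function.comp_def] at h0 h1 h2
    simp only [trueParam, h0, h1, h2]
  have hmean : ∀ k, ∫ ω, X 0 ω k ∂P = ∫ ω', H P₀ (g k) (A k) Z ω' ∂P₀ := fun k =>
    ((hXident 0).comp (u := fun x : EuclideanSpace ℝ K => x k) (by fun_prop)).integral_eq
  have hXm : ∀ i, Measurable (X i) := fun i => hφ.comp (by fun_prop)
  have hXL : MemLp (X 0) 2 P := by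
    refine MemLp.of_eval_piLp fun k => ?_
    refine MemLp.of_bound (by fun_prop) (|partialDeriv 0 (g k) (trueParam P₀ (A k) Z)|
      + |partialDeriv 1 (g k) (trueParam P₀ (A k) Z)|
      + |partialDeriv 2 (g k) (trueParam P₀ (A k) Z)|) (ae_of_all _ fun ω => ?_)
    refine (norm_add_le _ _).trans (add_le_add ((norm_add_le _ _).trans (add_le_add ?_ ?_)) ?_) <;>
      rw [norm_mul] <;> refine mul_le_of_le_one_right (norm_nonneg _) ?_ <;>
      rcases hAs 0 k ω with h | h <;> rcases hZs 0 ω with h' | h' <;> simp [h, h']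
  have hlin : TendstoInMeasure P
      (fun (n : ℕ) ω => (WithLp.toLp 2 (fun k => √(n : ℝ) * (Mhat n k ω - M k)
            - √(n : ℝ) * sampleMean (fun i ω =>
                linComb (g k) (trueParam P₀ (A k) Z) (As i k ω) (Zs i ω)
                  - ∫ ω', H P₀ (g k) (A k) Z ω' ∂P₀) n ω) : EuclideanSpace ℝ K))
        atTop (fun _ => (0 : EuclideanSpace ℝ K)) := by
    have hcoord : ∀ k, TendstoInMeasure P (fun (n : ℕ) ω => √(n : ℝ) * (Mhat n k ω - M k)
            - √(n : ℝ) * sampleMean (fun i ω =>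
                linComb (g k) (trueParam P₀ (A k) Z) (As i k ω) (Zs i ω)
                  - ∫ ω', H P₀ (g k) (A k) Z ω' ∂P₀) n ω) atTop (fun _ => (0 : ℝ)) := fun k => by
      have h := tendstoInMeasure_plugIn_sub_sampleMean (P := P) (A := fun i => As i k) (Z := Zs)
        (fun i => hAs_meas i k) hZs_meas (fun i => hAs i k) hZs
        (h_indep.comp (fun _ p => (p.1 k, p.2)) fun _ => by fun_prop)
        (fun i => hparam i k) (hg k)
      simp only [hMhat, hM, ← hmean]
      exact h
    exact (TendstoInMeasure.pi hcoord).lipschitz_comp (PiLp.lipschitzWith_toLp 2 _)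
  have hclt := tendstoInDistribution_multivariateGaussian (P := P) (X := X) hV.posSemidef
    (fun j k => by
      have hc : ∀ k : K, AEStronglyMeasurable (fun x : EuclideanSpace ℝ K => x k)
        (P.map (X 0)) := fun k => by fun_prop
      rw [← covariance_map_fun (hc j) (hc k) (hXm 0).aemeasurable, (hXident 0).map_eq,
        covariance_map_fun (by fun_prop) (by fun_prop) (hXident 0).aemeasurable_snd]
      rfl)
    hXL (h_indep.comp (fun _ => φ) fun _ => hφ) (fun i => (hXident i).trans (hXident 0).symm)
  have hnormal : TendstoInDistribution
      (fun (n : ℕ) ω => (WithLp.toLp 2 (fun k => √(n : ℝ) * (Mhat n k ω - M k)) :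
        EuclideanSpace ℝ K))
      atTop (id : EuclideanSpace ℝ K → EuclideanSpace ℝ K) (fun _ => P)
      (multivariateGaussian 0 (V P₀ g A Z)) := by
    refine tendstoInDistribution_of_tendstoInMeasure_sub _ _ hclt ?_ fun n => ?_
    · convert! hlin using 2 with n
      ext ω k
      have hPX : (P[X 0]) k = ∫ ω', H P₀ (g k) (A k) Z ω' ∂P₀ := by
        rw [eval_integral_piLp fun k => (MemLp.eval_piLp hXL k).integrable (by norm_num), hmean]
      simp only [Pi.sub_apply, PiLp.sub_apply, PiLp.smul_apply, hPX, smul_eq_mul, WithLp.ofLp_sum,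
        Finset.sum_apply, sampleMean]
      congr 1
      -- for `n = 0` all the normalizing factors vanish
      rcases Nat.eq_zero_or_pos n with rfl | hn
      · simp
      · have hn' : (0 : ℝ) < n := by exact_mod_cast hn
        have hs : √(n : ℝ) ≠ 0 := (Real.sqrt_pos.2 hn').ne'
        have hss : (n : ℝ) = √(n : ℝ) ^ 2 := (Real.sq_sqrt hn'.le).symm
        simp only [X, φ, Finset.sum_sub_distrib, Finset.sum_const, Finset.card_range,
          nsmul_eq_mul]
        generalize √(n : ℝ) = s at *
        rw [hss]
        field_simp
    · have : ∀ k, Measurable (Mhat n k) := fun k => by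
        rw [funext (hMhat n k)]
        exact measurable_comp_empParam (fun i => hAs_meas i k) hZs_meas (fun i => hAs i k) hZs _ n
      fun_prop
  have hR := corrMatrix_posSemidef hV
  have hdiag : ∀ k, corrMatrix (V P₀ g A Z) k k ≠ 0 := fun k => by simp [corrMatrix_diag hV]
  -- `s` is a single index for the individual intervals, and all of `K` for the joint ones
  have hcover : ∀ Vt : ℕ → K → K → Ω → ℝ, IsConsistent P Vt (V P₀ g A Z) →
      ∀ (q : ℝ) (qt : ℕ → Ω → ℝ), (∀ n, AEMeasurable (qt n) P) →
      TendstoInMeasure P qt atTop (fun _ => q) → ∀ s : Finset K, s.Nonempty →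
      Tendsto (fun n : ℕ => P.real {ω |
            ∀ k ∈ s, M k ∈ waldInterval (Mhat n k ω) (qt n ω) (Vt n k k ω) n})
          atTop (𝓝 ((multivariateGaussian (0 : EuclideanSpace ℝ K)
            (corrMatrix (V P₀ g A Z))).real {z | ∀ k ∈ s, |z k| ≤ q})) := by
    intro Vt hVt q qt hqm hqt s hs
    refine (tendsto_measureReal_forall_abs_le hV hnormal
      (W := fun n k ω => Vt n k k ω / V P₀ g A Z k k) (fun n k => (hVt.1 n k k).div_const _)
      (fun k => hVt.2 k k hV.diag_pos.ne') hqm hqt hs).congr' ?_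
    filter_upwards [eventually_gt_atTop 0] with n hn
    congr 1
    ext ω
    refine forall₂_congr fun k _ => ?_
    rw [mem_waldInterval_iff hn, mul_div_cancel₀ _ hV.diag_pos.ne']
  refine ⟨⟨hlin, hnormal⟩, fun Vt hVt α hα k => ?_, fun α hα =>
    ⟨exists_isMaxAbsQuantile hR hdiag hα, fun q hq Vt hVt qt hqm hqt => ?_⟩⟩
  · have h := hcover Vt hVt (stdNormalQuantile (1 - α / 2))
      (fun _ _ => stdNormalQuantile (1 - α / 2)) (fun _ => aemeasurable_const)
      (by simpa [tendstoInMeasure_iff_dist] using fun ε hε => by simp [not_le.2 hε])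
      {k} (Finset.singleton_nonempty k)
    have hmp := measurePreserving_eval_multivariateGaussian (μ := (0 : EuclideanSpace ℝ K)) hR
      (i := k)
    have hk := gaussianReal_real_abs_le_stdNormalQuantile hα
    rw [corrMatrix_diag hV, Real.toNNReal_one] at hmp
    rw [← hk]
    rw [show gaussianReal 0 1 = _ from hmp.map_eq.symm, map_measureReal_apply hmp.measurable
      (measurableSet_le (by fun_prop) measurable_const)]
    simpa using h
  · have h := hcover Vt hVt q qt hqm hqt Finset.univ Finset.univ_nonempty
    rw [← hq]
    simp only [Finset.mem_univ, true_imp_iff] at h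
    convert! h using 2
    refine measureReal_congr ?_
    filter_upwards [ae_sup_abs_ne_multivariateGaussian hR hdiag Finset.univ_nonempty q] with z hz
    refine propext ⟨fun h k => ?_, fun h => ?_⟩
    · exact ((Finset.sup'_lt_iff _).1 h k (Finset.mem_univ k)).le
    · exact lt_of_le_of_ne (Finset.sup'_le _ _ fun k _ => h k) hz
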